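/- Let $\mathbb{B}=\{q\in\mathbb{H}:|q|<1\}$ be the open unit ball of the quaternions, let $\mathbb{S}=\{I\in\mathbb{H}:\operatorname{Re}I=0,\ |I|=1\}$ be the sphere of imaginary units, with its usual (geodesic) spherical distance $d_{\mathbb{S}}$, and for $I\in\mathbb{S}$ let $L_I=\mathbb{R}+\mathbb{R}I$. Let $g$ be the Riemannian metric on $\mathbb{B}$ for which a tangent vector $d=d_1+d_2$ at $w\in\mathbb{B}\cap L_{I_w}$, with $d_1\in L_{I_w}$ and $d_2\in L_{I_w}^{\perp}$, has length $$|d|_{g(w)}^2=\frac{|d_1|^2}{(1-|w|^2)^2}+\frac{|d_2|^2}{|1-w^2|^2},$$ and let $d_g$ be the associated Riemannian distance (the infimum of the lengths of the piecewise $C^1$ curves in $\mathbb{B}$ joining two points). For $I_0\in\mathbb{S}$ let $\pi(x+yI)=x+yI_0$ ($x\in\mathbb{R}$, $y\ge 0$, $I\in\mathbb{S}$), and let $d_{hyp}$ be the hyperbolic distance on the disc $\mathbb{B}\cap L_{I_0}$, associated with the metric tensor $|dz|^2/(1-|z|^2)^2$. Then there are constants $c,C>0$ such that for every $I_0\in\mathbb{S}$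 and all $q_1,q_2\in\mathbb{B}$, written as $q_j=x_j+y_jI_j$ with $x_j\in\mathbb{R}$, $y_j\ge0$, $I_j\in\mathbb{S}$, $$c\,R(q_1,q_2)\le d_g(q_1,q_2)\le C\,R(q_1,q_2),$$ where $$R(q_1,q_2)=d_{hyp}(\pi(q_1),\pi(q_2))+\min\left\{\frac{y_1}{|1-q_1^2|},\frac{y_2}{|1-q_2^2|}\right\}d_{\mathbb{S}}(I_1,I_2).$$ -/

import Mathlib

open scoped Quaternion

noncomputable section

namespace QuatBall

/-- `γ` is piecewise continuously differentiable on `[a, b]`: there is a subdivision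
`a = t 0 ≤ t 1 ≤ ⋯ ≤ t n = b` such that `γ` is of class `C¹` on each closed piece. -/
def IsPiecewiseC1 (γ : ℝ → ℍ[ℝ]) (a b : ℝ) : Prop :=
  ContinuousOn γ (Set.Icc a b) ∧
  ∃ (n : ℕ) (t : ℕ → ℝ), Monotone t ∧ t 0 = a ∧ t n = b ∧
    ∀ i < n, ContDiffOn ℝ 1 γ (Set.Icc (t i) (t (i + 1)))

/-- The length of the curve `γ` on `[a, b]`, where the tangent vector `v` at the point `p` has
length `N p v`. -/
def curveLength (N : ℍ[ℝ] → ℍ[ℝ] → ℝ) (γ : ℝ → ℍ[ℝ]) (a b : ℝ) : ENNReal :=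
  ∫⁻ t in Set.Icc a b, ENNReal.ofReal (N (γ t) (deriv γ t))

/-- The distance on `U` associated with the length element `N`: the infimum of the lengths of
the piecewise `C¹` curves in `U` that join `p` to `q`. -/
def lengthDist (U : Set ℍ[ℝ]) (N : ℍ[ℝ] → ℍ[ℝ] → ℝ) (p q : ℍ[ℝ]) : ℝ :=
  (sInf {l : ENNReal | ∃ (γ : ℝ → ℍ[ℝ]) (a b : ℝ), a ≤ b ∧ IsPiecewiseC1 γ a b ∧
    (∀ t ∈ Set.Icc a b, γ t ∈ U) ∧ γ a = p ∧ γ b = q ∧ l = curveLength N γ a b}).toReal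

/-- The open unit ball `𝔹` of the quaternions. -/
def unitBall : Set ℍ[ℝ] := {q | ‖q‖ < 1}

/-- The sphere `𝕊` of imaginary units. -/
def imSphere : Set ℍ[ℝ] := {q | q.re = 0 ∧ ‖q‖ = 1}

/-- The slice `L_I = ℝ + ℝ I`. -/
def slice (I : ℍ[ℝ]) : Submodule ℝ ℍ[ℝ] := Submodule.span ℝ {1, I}

/-- The quaternion `i`. -/
def unitI : ℍ[ℝ] := ⟨0, 1, 0, 0⟩

open Classical in
/-- An imaginary unit `I_w` with `w ∈ L_{I_w}`, namely `Im w / |Im w|`. If `w` is real, any unit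
will do (the two coefficients of the metric below then agree), and we take `i`. -/
def unitOf (w : ℍ[ℝ]) : ℍ[ℝ] :=
  if w.im = 0 then unitI else ‖w.im‖⁻¹ • w.im

/-- The length `|d|_{g(w)}` of the tangent vector `d` at `w ∈ 𝔹`:
`|d|² = |d₁|² / (1 - |w|²)² + |d₂|² / |1 - w²|²`, where `d = d₁ + d₂`, `d₁ ∈ L_{I_w}` and
`d₂ ⟂ L_{I_w}`. -/
def gNorm (w d : ℍ[ℝ]) : ℝ :=
  let d₁ := (slice (unitOf w)).starProjection d
  let d₂ := d - d₁
  Real.sqrt (‖d₁‖ ^ 2 / (1 - ‖w‖ ^ 2) ^ 2 + ‖d₂‖ ^ 2 / ‖1 - w ^ 2‖ ^ 2)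

/-- The Riemannian distance `d_g` on `𝔹`. -/
def gDist : ℍ[ℝ] → ℍ[ℝ] → ℝ := lengthDist unitBall gNorm

/-- The hyperbolic distance on the disc `𝔹 ∩ L_I`, with length element `|dz| / (1 - |z|²)`. -/
def hypDist (I : ℍ[ℝ]) : ℍ[ℝ] → ℍ[ℝ] → ℝ :=
  lengthDist (unitBall ∩ (slice I : Set ℍ[ℝ])) (fun z v => ‖v‖ / (1 - ‖z‖ ^ 2))

/-- The spherical distance on `𝕊`, associated with the round metric. -/
def sphereDist : ℍ[ℝ] → ℍ[ℝ] → ℝ := lengthDist imSphere (fun _ v => ‖v‖)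

/-- The projection `x + y J ↦ x + y I`, for `x` real, `y ≥ 0` and `J ∈ 𝕊`. -/
def sliceProj (I q : ℍ[ℝ]) : ℍ[ℝ] := (q.re : ℍ[ℝ]) + ‖q.im‖ • I

end QuatBall

end

noncomputable section

namespace QuatBall

open Set MeasureTheory Filter Topology

/-! For the upper bound, rotate around the real axis at the endpoint where y/|1 - q²| is smaller,
and move inside a slice for the rest. A rotation has velocity orthogonal to the slices, so it costs
y/|1 - q²| times a spherical length; inside a slice g is the hyperbolic metric. This gives C = 1
(`gEDist_le`).

For the lower bound, two maps are tested on arbitrary curves. The projection π does not increase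
lengths, because its differential only sees the slice component of the velocity; it is not smooth at
the real axis, so it is approximated by `softProj` (`hypEDist_sliceProj_le`). The map V(q) = Im q/|1
- q²| is 4-Lipschitz from d_g to the Euclidean norm (`norm_deriv_imRatio_le`). As V(q_j) = r_j I_j
with r_j = y_j/|1 - q_j²|, and |r₁I₁ - r₂I₂| ≥ min(r₁, r₂)|I₁ - I₂|, comparing arcs with chords
bounds the angular term by 2π d_g (`min_mul_sphereDist_le`). Adding up, c = 1/(1 + 2π).

Estimates are made in `ENNReal`, since `toReal` would turn an infinite distance into 0; finiteness
is checked before converting. -/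

/-! ### Lengths of curves, Lipschitz maps, concatenation -/

/-- The distance `lengthDist`, before its conversion to a real number. -/
def elengthDist (U : Set ℍ[ℝ]) (N : ℍ[ℝ] → ℍ[ℝ] → ℝ) (p q : ℍ[ℝ]) : ENNReal :=
  sInf {l : ENNReal | ∃ (γ : ℝ → ℍ[ℝ]) (a b : ℝ), a ≤ b ∧ IsPiecewiseC1 γ a b ∧
    (∀ t ∈ Set.Icc a b, γ t ∈ U) ∧ γ a = p ∧ γ b = q ∧ l = curveLength N γ a b}

theorem lengthDist_eq_toReal (U : Set ℍ[ℝ]) (N : ℍ[ℝ] → ℍ[ℝ] → ℝ) (p q : ℍ[ℝ]) :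
    lengthDist U N p q = (elengthDist U N p q).toReal := rfl

theorem elengthDist_le {U : Set ℍ[ℝ]} {N : ℍ[ℝ] → ℍ[ℝ] → ℝ} {γ : ℝ → ℍ[ℝ]} {a b : ℝ}
    (hab : a ≤ b) (h : IsPiecewiseC1 γ a b) (hU : ∀ t ∈ Icc a b, γ t ∈ U) :
    elengthDist U N (γ a) (γ b) ≤ curveLength N γ a b :=
  sInf_le ⟨γ, a, b, hab, h, hU, rfl, rfl, rfl⟩

theorem isPiecewiseC1_of_contDiff {γ : ℝ → ℍ[ℝ]} (h : ContDiff ℝ 1 γ) {a b : ℝ} (hab : a ≤ b) :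
    IsPiecewiseC1 γ a b := by
  refine ⟨h.continuous.continuousOn, 1, fun i => if i = 0 then a else b, ?_, by simp, by simp,
    fun i _ => h.contDiffOn⟩
  refine monotone_nat_of_le_succ fun n => ?_
  by_cases hn : n = 0 <;> simp [hn, hab]

theorem exists_mem_Ioc_of_monotone {t : ℕ → ℝ} (ht : Monotone t) {n : ℕ} {x : ℝ}
    (hx : x ∈ Ioc (t 0) (t n)) : ∃ i < n, x ∈ Ioc (t i) (t (i + 1)) := by
  rw [← ht.biUnion_Ico_Ioc_map_succ 0 n] at hx
  simp only [mem_iUnion] at hx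
  obtain ⟨i, hi, hx⟩ := hx
  exact ⟨i, hi.2, hx⟩

/-- The exceptional points are the finitely many subdivision points and endpoints, a null set.
Length elements can therefore be compared pointwise, at interior times. -/
theorem IsPiecewiseC1.ae_differentiableAt {γ : ℝ → ℍ[ℝ]} {a b : ℝ} (h : IsPiecewiseC1 γ a b) :
    ∀ᵐ t ∂(volume.restrict (Icc a b)), t ∈ Ioo a b ∧ DifferentiableAt ℝ γ t := by
  obtain ⟨-, n, t, ht, h0, hn, hC⟩ := h
  rw [ae_restrict_iff' measurableSet_Icc]
  have hfin : (t '' Iic n ∪ {a, b}).Finite :=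
    ((finite_Iic n).image t).union (by simp)
  have : ∀ᵐ x : ℝ, x ∉ t '' Iic n ∪ {a, b} := by
    exact measure_eq_zero_iff_ae_notMem.1 (hfin.measure_zero volume)
  filter_upwards [this] with x hx hxI
  have hxa : x ≠ a := fun e => hx (by simp [e])
  have hxb : x ≠ b := fun e => hx (by simp [e])
  have hlt : x ∈ Ioc (t 0) (t n) := by
    rw [h0, hn]; exact ⟨lt_of_le_of_ne hxI.1 (Ne.symm hxa), hxI.2⟩
  refine ⟨⟨lt_of_le_of_ne hxI.1 (Ne.symm hxa), lt_of_le_of_ne hxI.2 hxb⟩, ?_⟩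
  obtain ⟨i, hi, hxi⟩ := exists_mem_Ioc_of_monotone ht hlt
  have hne : x ≠ t (i + 1) := fun e => hx (Or.inl ⟨i + 1, by simpa using hi, e.symm⟩)
  exact ((hC i hi).differentiableOn one_ne_zero).differentiableAt
    (Icc_mem_nhds hxi.1 (lt_of_le_of_ne hxi.2 hne))

theorem IsPiecewiseC1.comp {γ : ℝ → ℍ[ℝ]} {a b : ℝ} (h : IsPiecewiseC1 γ a b)
    {U : Set ℍ[ℝ]} {Φ : ℍ[ℝ] → ℍ[ℝ]} (hΦ : ContDiffOn ℝ 1 Φ U) (hU : ∀ t ∈ Icc a b, γ t ∈ U) :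
    IsPiecewiseC1 (fun t => Φ (γ t)) a b := by
  obtain ⟨hc, n, t, ht, h0, hn, hC⟩ := h
  refine ⟨hΦ.continuousOn.comp hc hU, n, t, ht, h0, hn, fun i hi => ?_⟩
  refine hΦ.comp (hC i hi) fun s hs => hU s ⟨?_, ?_⟩
  · rw [← h0]; exact (ht (Nat.zero_le i)).trans hs.1
  · rw [← hn]; exact hs.2.trans (ht hi)

/-- If a `C¹` map multiplies the lengths of the tangent vectors of curves in `U` by at most `K`,
it multiplies the distances by at most `K`. -/
theorem elengthDist_comp_le {U U' : Set ℍ[ℝ]} {N N' : ℍ[ℝ] → ℍ[ℝ] → ℝ} {Φ : ℍ[ℝ] → ℍ[ℝ]}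
    {K : ℝ} (hK : 0 ≤ K) (hΦ : ContDiffOn ℝ 1 Φ U) (hUU' : ∀ z ∈ U, Φ z ∈ U')
    (hN : ∀ (γ : ℝ → ℍ[ℝ]) (t : ℝ) (v : ℍ[ℝ]), (∀ᶠ s in 𝓝 t, γ s ∈ U) → HasDerivAt γ v t →
      ∃ v', HasDerivAt (fun s => Φ (γ s)) v' t ∧ N' (Φ (γ t)) v' ≤ K * N (γ t) v)
    {p q : ℍ[ℝ]} (hfin : elengthDist U N p q ≠ ⊤) :
    elengthDist U' N' (Φ p) (Φ q) ≤ ENNReal.ofReal K * elengthDist U N p q := by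
  unfold elengthDist at hfin ⊢
  set S := {l : ENNReal | ∃ (γ : ℝ → ℍ[ℝ]) (a b : ℝ), a ≤ b ∧ IsPiecewiseC1 γ a b ∧
    (∀ t ∈ Set.Icc a b, γ t ∈ U) ∧ γ a = p ∧ γ b = q ∧ l = curveLength N γ a b} with hS
  -- Without a joining curve the infimum is `⊤`, and for `K = 0` the right-hand side would be `0 * ⊤
  -- = 0`.
  have hne : S.Nonempty := by
    by_contra h
    rw [not_nonempty_iff_eq_empty] at h
    simp [h] at hfin
  have := hne.to_subtype
  rw [sInf_eq_iInf' S, ENNReal.mul_iInf (by simp)]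
  refine le_iInf ?_
  rintro ⟨l, γ, a, b, hab, hγ, hU, rfl, rfl, rfl⟩
  refine (elengthDist_le (N := N') hab (hγ.comp hΦ hU)
    (fun t ht => hUU' _ (hU t ht))).trans ?_
  unfold curveLength
  rw [← lintegral_const_mul' _ _ ENNReal.ofReal_ne_top]
  refine lintegral_mono_ae ?_
  filter_upwards [hγ.ae_differentiableAt] with t ht
  obtain ⟨v', hv', hle⟩ := hN γ t (deriv γ t)
    (by filter_upwards [Icc_mem_nhds ht.1.1 ht.1.2] with s hs using hU s hs) ht.2.hasDerivAt
  rw [← ENNReal.ofReal_mul hK, hv'.deriv]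
  exact ENNReal.ofReal_le_ofReal hle

theorem enorm_sub_le_curveLength {γ : ℝ → ℍ[ℝ]} {a b : ℝ} (h : IsPiecewiseC1 γ a b) :
    ‖γ b - γ a‖ₑ ≤ curveLength (fun _ v => ‖v‖) γ a b := by
  obtain ⟨-, n, t, ht, h0, hn, hC⟩ := h
  have key : ∀ m ≤ n, ‖γ (t m) - γ (t 0)‖ₑ ≤ ∫⁻ x in Ioc (t 0) (t m), ‖deriv γ x‖ₑ := by
    intro m
    induction m with
    | zero => simp
    | succ m ih =>
      intro hm
      have h1 := ih (by omega)
      have h2 := _root_.enorm_sub_le_lintegral_deriv_of_contDiffOn_Icc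
        (hC m (by omega)) (ht (Nat.le_succ m))
      rw [← Ioc_union_Ioc_eq_Ioc (ht (Nat.zero_le m)) (ht (Nat.le_succ m)),
        lintegral_union measurableSet_Ioc (Ioc_disjoint_Ioc_of_le le_rfl)]
      rw [← restrict_Ioc_eq_restrict_Icc] at h2
      calc _ = ‖(γ (t m) - γ (t 0)) + (γ (t (m + 1)) - γ (t m))‖ₑ := by congr 1; abel
        _ ≤ _ := enorm_add_le _ _
        _ ≤ _ := add_le_add h1 h2
  have := key n le_rfl
  rw [h0, hn, restrict_Ioc_eq_restrict_Icc] at this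
  simpa [curveLength, ofReal_norm] using this

theorem enorm_sub_le_elengthDist (U : Set ℍ[ℝ]) (p q : ℍ[ℝ]) :
    ‖q - p‖ₑ ≤ elengthDist U (fun _ v => ‖v‖) p q := by
  refine le_sInf ?_
  rintro l ⟨γ, a, b, hab, hγ, hU, rfl, rfl, rfl⟩
  exact enorm_sub_le_curveLength hγ

/-- The curve that runs through `γ₁` up to time `b`, and then through `γ₂` from time `c` on. -/
def concat (γ₁ γ₂ : ℝ → ℍ[ℝ]) (b c : ℝ) (t : ℝ) : ℍ[ℝ] :=
  if t ≤ b then γ₁ t else γ₂ (t - b + c)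

theorem concat_of_ge {γ₁ γ₂ : ℝ → ℍ[ℝ]} {b c t : ℝ} (h : γ₁ b = γ₂ c) (ht : b ≤ t) :
    concat γ₁ γ₂ b c t = γ₂ (t - b + c) := by
  unfold concat
  split_ifs with h'
  · obtain rfl := le_antisymm ht h'
    simpa using h
  · rfl

theorem IsPiecewiseC1.concat {γ₁ γ₂ : ℝ → ℍ[ℝ]} {a b c d : ℝ} (h₁ : IsPiecewiseC1 γ₁ a b)
    (h₂ : IsPiecewiseC1 γ₂ c d) (hab : a ≤ b) (hcd : c ≤ d) (h : γ₁ b = γ₂ c) :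
    IsPiecewiseC1 (concat γ₁ γ₂ b c) a (b + (d - c)) := by
  obtain ⟨hc₁, n₁, t₁, ht₁, h0₁, hn₁, hC₁⟩ := h₁
  obtain ⟨hc₂, n₂, t₂, ht₂, h0₂, hn₂, hC₂⟩ := h₂
  refine ⟨?_, n₁ + n₂, fun i => if i ≤ n₁ then t₁ i else t₂ (i - n₁) - c + b, ?_, ?_, ?_, ?_⟩
  · rw [← Icc_union_Icc_eq_Icc hab (by linarith : b ≤ b + (d - c))]
    refine ContinuousOn.union_of_isClosed ?_ ?_ isClosed_Icc isClosed_Icc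
    · exact hc₁.congr fun t ht => by simp [QuatBall.concat, ht.2]
    · refine ContinuousOn.congr (f := fun t => γ₂ (t - b + c)) ?_
        fun t ht => concat_of_ge h ht.1
      refine hc₂.comp (by fun_prop) fun t ht => ⟨by linarith [ht.1], by linarith [ht.2]⟩
  · refine monotone_nat_of_le_succ fun i => ?_
    rcases lt_trichotomy i n₁ with hi | rfl | hi
    · rw [if_pos hi.le, if_pos (Nat.succ_le_of_lt hi)]; exact ht₁ (Nat.le_succ i)
    · rw [if_pos le_rfl, if_neg (by omega), hn₁]
      have := ht₂ (Nat.zero_le (i + 1 - i))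
      linarith
    · rw [if_neg (by omega), if_neg (by omega)]
      have := ht₂ (show i - n₁ ≤ i + 1 - n₁ by omega)
      linarith
  · simpa using h0₁
  · by_cases h0 : n₂ = 0
    · subst h0
      simp [hn₁]; linarith
    · simp only [Nat.add_sub_cancel_left, hn₂]
      rw [if_neg (by omega)]; ring
  · intro i hi
    dsimp only
    by_cases hi' : i + 1 ≤ n₁
    · rw [if_pos hi', if_pos (by omega)]
      refine (hC₁ i (by omega)).congr fun t ht => ?_
      have : t ≤ b := ht.2.trans (hn₁ ▸ ht₁ hi')
      simp [QuatBall.concat, this]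
    -- At the junction `i = n₁` both formulas for the subdivision point give `b`.
    · have e : (if i ≤ n₁ then t₁ i else t₂ (i - n₁) - c + b) = t₂ (i - n₁) - c + b := by
        split_ifs with h'
        · obtain rfl : i = n₁ := by omega
          simp [hn₁, h0₂]
        · rfl
      rw [e, if_neg hi', show i + 1 - n₁ = (i - n₁) + 1 by omega]
      have hge : b ≤ t₂ (i - n₁) - c + b := by
        have := ht₂ (Nat.zero_le (i - n₁)); linarith
      refine ContDiffOn.congr (f := fun t => γ₂ (t - b + c)) ?_
        fun t ht => concat_of_ge h (hge.trans ht.1)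
      refine (hC₂ (i - n₁) (by omega)).comp (by fun_prop)
        fun t ht => ⟨by linarith [ht.1], by linarith [ht.2]⟩

theorem curveLength_concat {N : ℍ[ℝ] → ℍ[ℝ] → ℝ} {γ₁ γ₂ : ℝ → ℍ[ℝ]} {a b c d : ℝ}
    (hab : a ≤ b) (hcd : c ≤ d) :
    curveLength N (concat γ₁ γ₂ b c) a (b + (d - c)) =
      curveLength N γ₁ a b + curveLength N γ₂ c d := by
  unfold curveLength
  -- On open intervals the concatenation agrees locally with one of the two curves, hence so do the
  -- derivatives; at the junction it may have a corner.
  simp only [← restrict_Ioo_eq_restrict_Icc]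
  rw [restrict_Ioo_eq_restrict_Ioc,
    ← Ioc_union_Ioc_eq_Ioc hab (by linarith : b ≤ b + (d - c)),
    lintegral_union measurableSet_Ioc (Ioc_disjoint_Ioc_of_le le_rfl),
    ← restrict_Ioo_eq_restrict_Ioc, ← restrict_Ioo_eq_restrict_Ioc]
  congr 1
  · refine setLIntegral_congr_fun measurableSet_Ioo fun t ht => ?_
    have he : concat γ₁ γ₂ b c =ᶠ[𝓝 t] γ₁ := by
      filter_upwards [Iio_mem_nhds ht.2] with s hs
      simp [concat, le_of_lt (mem_Iio.1 hs)]
    simp only [he.deriv_eq, he.eq_of_nhds]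
  · have hpre : (fun t : ℝ => t + (c - b)) ⁻¹' Ioo c d = Ioo b (b + (d - c)) := by
      ext t; simp only [mem_preimage, mem_Ioo]
      constructor <;> rintro ⟨h1, h2⟩ <;> constructor <;> linarith
    have hshift := (measurePreserving_add_right (volume : Measure ℝ)
      (c - b)).setLIntegral_comp_preimage_emb (MeasurableEquiv.addRight (c - b)).measurableEmbedding
      (fun t => ENNReal.ofReal (N (γ₂ t) (deriv γ₂ t))) (Ioo c d)
    rw [← hshift, hpre]
    refine setLIntegral_congr_fun measurableSet_Ioo fun t ht => ?_
    have he : concat γ₁ γ₂ b c =ᶠ[𝓝 t] fun s => γ₂ (s + (c - b)) := by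
      filter_upwards [Ioi_mem_nhds ht.1] with s hs
      have : ¬ s ≤ b := not_le.2 hs
      simp only [concat, this, if_false]
      congr 1; ring
    simp only [he.deriv_eq, he.eq_of_nhds, deriv_comp_add_const]

theorem elengthDist_triangle (U : Set ℍ[ℝ]) (N : ℍ[ℝ] → ℍ[ℝ] → ℝ) (p q r : ℍ[ℝ]) :
    elengthDist U N p r ≤ elengthDist U N p q + elengthDist U N q r := by
  unfold elengthDist
  rw [sInf_eq_iInf' {l : ENNReal | ∃ (γ : ℝ → ℍ[ℝ]) (a b : ℝ), a ≤ b ∧ IsPiecewiseC1 γ a b ∧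
    (∀ t ∈ Set.Icc a b, γ t ∈ U) ∧ γ a = p ∧ γ b = q ∧ l = curveLength N γ a b},
    sInf_eq_iInf' {l : ENNReal | ∃ (γ : ℝ → ℍ[ℝ]) (a b : ℝ), a ≤ b ∧ IsPiecewiseC1 γ a b ∧
    (∀ t ∈ Set.Icc a b, γ t ∈ U) ∧ γ a = q ∧ γ b = r ∧ l = curveLength N γ a b}]
  refine ENNReal.le_iInf_add_iInf ?_
  rintro ⟨l₁, γ₁, a, b, hab, h₁, hU₁, rfl, rfl, rfl⟩ ⟨l₂, γ₂, c, d, hcd, h₂, hU₂, he, rfl, rfl⟩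
  refine sInf_le ⟨concat γ₁ γ₂ b c, a, b + (d - c), by linarith, h₁.concat h₂ hab hcd he.symm,
    fun t ht => ?_, by simp [concat, hab], ?_, (curveLength_concat hab hcd).symm⟩
  · by_cases htb : t ≤ b
    · simpa [concat, htb] using hU₁ t ⟨ht.1, htb⟩
    · rw [concat_of_ge he.symm (not_le.1 htb).le]
      exact hU₂ _ ⟨by linarith, by linarith [ht.2]⟩
  · rw [concat_of_ge he.symm (by linarith)]
    congr 1; ring

/-! ### Quaternionic norms and the metric g -/

theorem norm_sq_eq (q : ℍ[ℝ]) : ‖q‖ ^ 2 = q.re ^ 2 + q.imI ^ 2 + q.imJ ^ 2 + q.imK ^ 2 := by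
  rw [sq ‖q‖, ← Quaternion.normSq_eq_norm_mul_self, Quaternion.normSq_def']

theorem inner_eq (p q : ℍ[ℝ]) :
    inner ℝ p q = p.re * q.re + p.imI * q.imI + p.imJ * q.imJ + p.imK * q.imK := by
  rw [Quaternion.inner_def]; simp

theorem norm_sq_eq_re_im (q : ℍ[ℝ]) : ‖q‖ ^ 2 = q.re ^ 2 + ‖q.im‖ ^ 2 := by
  simp only [norm_sq_eq]; simp; ring

/-- This identity governs both coefficients of g: it gives 1 - |q|² ≤ |1 - q²|, invariance of |1 -
q²| under rotation, and its smoothness on the ball. -/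
theorem norm_one_sub_sq (q : ℍ[ℝ]) :
    ‖1 - q ^ 2‖ ^ 2 = (1 - ‖q‖ ^ 2) ^ 2 + 4 * ‖q.im‖ ^ 2 := by
  simp only [norm_sq_eq]; simp [sq]; ring

theorem one_sub_norm_sq_pos {q : ℍ[ℝ]} (hq : q ∈ unitBall) : 0 < 1 - ‖q‖ ^ 2 := by
  have h : ‖q‖ < 1 := hq
  nlinarith [norm_nonneg q]

theorem one_sub_norm_sq_le (q : ℍ[ℝ]) : 1 - ‖q‖ ^ 2 ≤ ‖1 - q ^ 2‖ := by
  refine (abs_le_of_sq_le_sq' ?_ (norm_nonneg _)).2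
  rw [norm_one_sub_sq]; nlinarith [sq_nonneg ‖q.im‖]

theorem norm_one_sub_sq_pos {q : ℍ[ℝ]} (hq : q ∈ unitBall) : 0 < ‖1 - q ^ 2‖ :=
  (one_sub_norm_sq_pos hq).trans_le (one_sub_norm_sq_le q)

theorem unitI_mem_imSphere : unitI ∈ imSphere := by
  refine ⟨rfl, ?_⟩
  have h := norm_sq_eq unitI
  rw [← sq_eq_sq₀ (norm_nonneg _) zero_le_one, h]
  simp [unitI]

theorem unitOf_mem_imSphere (w : ℍ[ℝ]) : unitOf w ∈ imSphere := by
  unfold unitOf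
  split_ifs with h
  · exact unitI_mem_imSphere
  · refine ⟨by simp, ?_⟩
    rw [norm_smul, norm_inv, norm_norm, inv_mul_cancel₀ (norm_ne_zero_iff.2 h)]

theorem norm_smul_unitOf (w : ℍ[ℝ]) : ‖w.im‖ • unitOf w = w.im := by
  unfold unitOf
  split_ifs with h
  · simp [h]
  · rw [smul_smul, mul_inv_cancel₀ (norm_ne_zero_iff.2 h), one_smul]

theorem starProjection_slice {I : ℍ[ℝ]} (hI : I ∈ imSphere) (d : ℍ[ℝ]) :
    (slice I).starProjection d = (d.re : ℍ[ℝ]) + (inner ℝ I d : ℝ) • I := by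
  refine Submodule.eq_starProjection_of_mem_of_inner_eq_zero ?_ ?_
  · refine add_mem ?_ (Submodule.smul_mem _ _ (Submodule.subset_span (by simp)))
    have : (d.re : ℍ[ℝ]) = d.re • (1 : ℍ[ℝ]) := by ext <;> simp
    rw [this]
    exact Submodule.smul_mem _ _ (Submodule.subset_span (by simp))
  · intro w hw
    obtain ⟨s, t, rfl⟩ := Submodule.mem_span_pair.1 hw
    have h1 : inner ℝ I I = 1 := by rw [real_inner_self_eq_norm_sq, hI.2]; norm_num
    have h2 := hI.1
    simp only [inner_eq] at h1 ⊢
    simp [h2] at h1 ⊢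
    linear_combination (-(t * (I.imI * d.imI + I.imJ * d.imJ + I.imK * d.imK))) * h1

theorem norm_sq_starProjection_slice {I : ℍ[ℝ]} (hI : I ∈ imSphere) (d : ℍ[ℝ]) :
    ‖(slice I).starProjection d‖ ^ 2 = d.re ^ 2 + (inner ℝ I d) ^ 2 := by
  rw [starProjection_slice hI, norm_sq_eq_re_im]
  have h2 := hI.1
  have : ((d.re : ℍ[ℝ]) + (inner ℝ I d : ℝ) • I).im = (inner ℝ I d : ℝ) • I := by
    ext <;> simp [h2]
  rw [this, norm_smul, hI.2]
  simp [h2]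

/-- The component of `d` in the slice through `w`. -/
def tangentPart (w d : ℍ[ℝ]) : ℍ[ℝ] := (slice (unitOf w)).starProjection d

theorem gNorm_sq (w d : ℍ[ℝ]) : gNorm w d ^ 2 =
    ‖tangentPart w d‖ ^ 2 / (1 - ‖w‖ ^ 2) ^ 2 + ‖d - tangentPart w d‖ ^ 2 / ‖1 - w ^ 2‖ ^ 2 :=
  Real.sq_sqrt (by positivity)

theorem gNorm_nonneg (w d : ℍ[ℝ]) : 0 ≤ gNorm w d := Real.sqrt_nonneg _

theorem norm_sq_tangentPart_add (w d : ℍ[ℝ]) :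
    ‖tangentPart w d‖ ^ 2 + ‖d - tangentPart w d‖ ^ 2 = ‖d‖ ^ 2 := by
  have h := Submodule.norm_sq_eq_add_norm_sq_starProjection d (slice (unitOf w))
  rw [Submodule.starProjection_orthogonal_val] at h
  exact h.symm

theorem norm_tangentPart_le (w d : ℍ[ℝ]) :
    ‖tangentPart w d‖ / (1 - ‖w‖ ^ 2) ≤ gNorm w d := by
  refine abs_le_of_sq_le_sq' ?_ (gNorm_nonneg w d) |>.2
  rw [gNorm_sq, div_pow]
  exact le_add_of_nonneg_right (by positivity)

theorem norm_sub_tangentPart_le (w d : ℍ[ℝ]) :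
    ‖d - tangentPart w d‖ / ‖1 - w ^ 2‖ ≤ gNorm w d := by
  refine abs_le_of_sq_le_sq' ?_ (gNorm_nonneg w d) |>.2
  rw [gNorm_sq, div_pow]
  exact le_add_of_nonneg_left (by positivity)

/-- The slice coefficient is the larger of the two, since 1 - |w|² ≤ |1 - w²|. -/
theorem gNorm_le {w : ℍ[ℝ]} (hw : w ∈ unitBall) (d : ℍ[ℝ]) :
    gNorm w d ≤ ‖d‖ / (1 - ‖w‖ ^ 2) := by
  have h := one_sub_norm_sq_pos hw
  refine abs_le_of_sq_le_sq' ?_ (by positivity) |>.2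
  rw [gNorm_sq, div_pow, ← norm_sq_tangentPart_add w d, add_div]
  gcongr
  exact one_sub_norm_sq_le w

theorem inner_im (p q : ℍ[ℝ]) : inner ℝ p.im q.im = inner ℝ p.im q := by
  simp [inner_eq]

theorem inner_im_eq (w d : ℍ[ℝ]) : inner ℝ w.im d = ‖w.im‖ * inner ℝ (unitOf w) d := by
  conv_lhs => rw [← norm_smul_unitOf w, real_inner_smul_left]

theorem norm_sq_tangentPart (w d : ℍ[ℝ]) :
    ‖tangentPart w d‖ ^ 2 = d.re ^ 2 + (inner ℝ (unitOf w) d) ^ 2 :=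
  norm_sq_starProjection_slice (unitOf_mem_imSphere w) d

/-- Both Im w and w lie in the slice through w, so their inner products with d only see the slice
component of d. Hence the derivatives of |w|² and |Im w|² along a curve never involve the orthogonal
component. -/
theorem abs_inner_im_le (w d : ℍ[ℝ]) :
    |inner ℝ w.im d| ≤ ‖w.im‖ * ‖tangentPart w d‖ := by
  rw [inner_im_eq, abs_mul, abs_norm]
  gcongr
  refine abs_le_of_sq_le_sq ?_ (norm_nonneg _)
  rw [norm_sq_tangentPart]; nlinarith [sq_nonneg d.re]

theorem abs_inner_le (w d : ℍ[ℝ]) : |inner ℝ w d| ≤ ‖w‖ * ‖tangentPart w d‖ := by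
  refine abs_le_of_sq_le_sq ?_ (by positivity)
  have h : inner ℝ w d = w.re * d.re + ‖w.im‖ * inner ℝ (unitOf w) d := by
    rw [← inner_im_eq]; simp [inner_eq]; ring
  rw [mul_pow, norm_sq_tangentPart, norm_sq_eq_re_im, h]
  nlinarith [sq_nonneg (w.re * inner ℝ (unitOf w) d - ‖w.im‖ * d.re)]

/-- A tangent vector orthogonal to the slice through `w`. -/
theorem gNorm_of_orthogonal {w d : ℍ[ℝ]} (h0 : d.re = 0) (h1 : inner ℝ (unitOf w) d = 0) :
    gNorm w d = ‖d‖ / ‖1 - w ^ 2‖ := by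
  have h : tangentPart w d = 0 := by
    rw [tangentPart, starProjection_slice (unitOf_mem_imSphere w), h0, h1]; simp
  have h2 := gNorm_sq w d
  rw [h] at h2
  simp only [norm_zero, sub_zero] at h2
  rw [← abs_of_nonneg (gNorm_nonneg w d), ← abs_of_nonneg (by positivity : 0 ≤ ‖d‖ / ‖1 - w ^ 2‖),
    ← sq_eq_sq_iff_abs_eq_abs, h2, div_pow]
  simp

/-! ### Coordinates x + yI, motion in a slice, rotations -/

/-- The real part, as a continuous linear map. -/
def reL : ℍ[ℝ] →L[ℝ] ℝ :=
  LinearMap.toContinuousLinearMap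
    { toFun := fun q => q.re, map_add' := fun _ _ => rfl, map_smul' := fun _ _ => by simp }

/-- The imaginary part, as a continuous linear map. -/
def imL : ℍ[ℝ] →L[ℝ] ℍ[ℝ] :=
  LinearMap.toContinuousLinearMap
    { toFun := fun q => q.im, map_add' := fun _ _ => by simp, map_smul' := fun _ _ => by simp }

@[simp] theorem reL_apply (q : ℍ[ℝ]) : reL q = q.re := rfl

@[simp] theorem imL_apply (q : ℍ[ℝ]) : imL q = q.im := rfl

theorem coe_eq_smul_one (r : ℝ) : (r : ℍ[ℝ]) = r • (1 : ℍ[ℝ]) := by ext <;> simp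

theorem norm_sq_coe_add_smul {I : ℍ[ℝ]} (hI : I ∈ imSphere) (x y : ℝ) :
    ‖(x : ℍ[ℝ]) + y • I‖ ^ 2 = x ^ 2 + y ^ 2 := by
  have h : ((x : ℍ[ℝ]) + y • I).im = y • I := by ext <;> simp [hI.1]
  rw [norm_sq_eq_re_im, h, norm_smul, hI.2]
  simp [hI.1]

theorem re_coe_add_smul {I : ℍ[ℝ]} (hI : I ∈ imSphere) (x y : ℝ) :
    ((x : ℍ[ℝ]) + y • I).re = x := by simp [hI.1]

theorem im_coe_add_smul {I : ℍ[ℝ]} (hI : I ∈ imSphere) (x y : ℝ) :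
    ((x : ℍ[ℝ]) + y • I).im = y • I := by ext <;> simp [hI.1]

theorem norm_im_coe_add_smul {I : ℍ[ℝ]} (hI : I ∈ imSphere) (x : ℝ) {y : ℝ} (hy : 0 ≤ y) :
    ‖((x : ℍ[ℝ]) + y • I).im‖ = y := by
  rw [im_coe_add_smul hI, norm_smul, hI.2, Real.norm_of_nonneg hy, mul_one]

theorem coe_add_smul_mem_slice (I : ℍ[ℝ]) (x y : ℝ) : (x : ℍ[ℝ]) + y • I ∈ slice I := by
  rw [coe_eq_smul_one]
  exact Submodule.mem_span_pair.2 ⟨x, y, rfl⟩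

theorem norm_coe_add_smul_le {I J : ℍ[ℝ]} (hI : I ∈ imSphere) (hJ : J ∈ imSphere) (x : ℝ)
    {y y' : ℝ} (h : y ^ 2 ≤ y' ^ 2) : ‖(x : ℍ[ℝ]) + y • I‖ ≤ ‖(x : ℍ[ℝ]) + y' • J‖ := by
  refine (abs_le_of_sq_le_sq' ?_ (norm_nonneg _)).2
  rw [norm_sq_coe_add_smul hI, norm_sq_coe_add_smul hJ]
  linarith

theorem norm_one_sub_sq_coe_add_smul {I J : ℍ[ℝ]} (hI : I ∈ imSphere) (hJ : J ∈ imSphere)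
    (x y : ℝ) : ‖1 - ((x : ℍ[ℝ]) + y • I) ^ 2‖ = ‖1 - ((x : ℍ[ℝ]) + y • J) ^ 2‖ := by
  rw [← sq_eq_sq₀ (norm_nonneg _) (norm_nonneg _), norm_one_sub_sq, norm_one_sub_sq,
    norm_sq_coe_add_smul hI, norm_sq_coe_add_smul hJ, im_coe_add_smul hI, im_coe_add_smul hJ,
    norm_smul, norm_smul, hI.2, hJ.2]

/-- The length element of the hyperbolic metric. -/
abbrev hypNorm (z v : ℍ[ℝ]) : ℝ := ‖v‖ / (1 - ‖z‖ ^ 2)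

/-- The linear map that sends `x + y I` to `x + y J`, and is zero on the orthogonal of the
slice `L_I`. -/
def sliceMap (I J : ℍ[ℝ]) : ℍ[ℝ] →L[ℝ] ℍ[ℝ] :=
  reL.smulRight 1 + (innerSL ℝ I).smulRight J

theorem sliceMap_apply (I J z : ℍ[ℝ]) :
    sliceMap I J z = (z.re : ℍ[ℝ]) + (inner ℝ I z : ℝ) • J := by
  simp [sliceMap, coe_eq_smul_one]

theorem sliceMap_coe_add_smul {I : ℍ[ℝ]} (hI : I ∈ imSphere) (J : ℍ[ℝ]) (x y : ℝ) :
    sliceMap I J ((x : ℍ[ℝ]) + y • I) = (x : ℍ[ℝ]) + y • J := by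
  have h : inner ℝ I ((x : ℍ[ℝ]) + y • I) = y := by
    rw [inner_add_right, real_inner_smul_right, real_inner_self_eq_norm_sq, hI.2, inner_eq]
    simp [hI.1]
  rw [sliceMap_apply, h, re_coe_add_smul hI]

theorem norm_sliceMap_le {I J : ℍ[ℝ]} (hI : I ∈ imSphere) (hJ : J ∈ imSphere) (z : ℍ[ℝ]) :
    ‖sliceMap I J z‖ ≤ ‖z‖ := by
  refine (abs_le_of_sq_le_sq' ?_ (norm_nonneg _)).2
  rw [sliceMap_apply, norm_sq_coe_add_smul hJ, norm_sq_eq_re_im]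
  have h : inner ℝ I z = inner ℝ I z.im := by simp [inner_eq, hI.1]
  have h2 := abs_real_inner_le_norm I z.im
  rw [hI.2, one_mul, ← h] at h2
  have := sq_le_sq' (abs_le.1 h2).1 (abs_le.1 h2).2
  linarith

/-- The embeddings of the half discs as slices do not increase distances. -/
theorem gEDist_sliceMap_le {I J : ℍ[ℝ]} (hI : I ∈ imSphere) (hJ : J ∈ imSphere) {p q : ℍ[ℝ]}
    (hfin : elengthDist (unitBall ∩ (slice I : Set ℍ[ℝ])) hypNorm p q ≠ ⊤) :
    elengthDist unitBall gNorm (sliceMap I J p) (sliceMap I J q) ≤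
      elengthDist (unitBall ∩ (slice I : Set ℍ[ℝ])) hypNorm p q := by
  have hball : ∀ z ∈ unitBall, sliceMap I J z ∈ unitBall :=
    fun z hz => (norm_sliceMap_le hI hJ z).trans_lt hz
  have := elengthDist_comp_le (U' := unitBall) (N' := gNorm) zero_le_one
    (sliceMap I J).contDiff.contDiffOn (fun z hz => hball z hz.1) ?_ hfin
  · simpa using this
  · intro γ t v hU hv
    refine ⟨sliceMap I J v, (sliceMap I J).hasFDerivAt.comp_hasDerivAt t hv, ?_⟩
    have ht := hU.self_of_nhds.1
    refine (gNorm_le (hball _ ht) _).trans ?_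
    rw [one_mul]
    have := one_sub_norm_sq_pos ht
    have := norm_sliceMap_le hI hJ v
    have := norm_sliceMap_le hI hJ (γ t)
    unfold hypNorm
    gcongr

/-- Differentiate Re γ = 0 and |γ|² = 1. This makes the velocity of a rotating point orthogonal to
its slice. -/
theorem inner_eq_zero_of_mem_imSphere {γ : ℝ → ℍ[ℝ]} {t : ℝ} {v : ℍ[ℝ]}
    (hU : ∀ᶠ s in 𝓝 t, γ s ∈ imSphere) (hv : HasDerivAt γ v t) :
    v.re = 0 ∧ inner ℝ (γ t) v = 0 := by
  constructor
  · have h1 : HasDerivAt (fun s => (γ s).re) v.re t := reL.hasFDerivAt.comp_hasDerivAt t hv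
    have h2 : (fun s => (γ s).re) =ᶠ[𝓝 t] fun _ => 0 := by
      filter_upwards [hU] with s hs using hs.1
    exact (h1.congr_of_eventuallyEq h2.symm).unique (hasDerivAt_const t (0 : ℝ))
  · have h1 := hv.norm_sq
    have h2 : (fun s => ‖γ s‖ ^ 2) =ᶠ[𝓝 t] fun _ => 1 := by
      filter_upwards [hU] with s hs
      rw [hs.2, one_pow]
    have := (h1.congr_of_eventuallyEq h2.symm).unique (hasDerivAt_const t (1 : ℝ))
    linarith

/-- Rotations around the real axis. -/
theorem gEDist_rotate_le {x y : ℝ} (hy : 0 ≤ y) {I J : ℍ[ℝ]} (hI : I ∈ imSphere)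
    (hq : (x : ℍ[ℝ]) + y • I ∈ unitBall)
    (hfin : elengthDist imSphere (fun _ v => ‖v‖) I J ≠ ⊤) :
    elengthDist unitBall gNorm ((x : ℍ[ℝ]) + y • I) ((x : ℍ[ℝ]) + y • J) ≤
      ENNReal.ofReal (y / ‖1 - ((x : ℍ[ℝ]) + y • I) ^ 2‖) *
        elengthDist imSphere (fun _ v => ‖v‖) I J := by
  refine elengthDist_comp_le (Φ := fun σ => (x : ℍ[ℝ]) + y • σ) (by positivity)
    (by fun_prop) (fun σ hσ => (norm_coe_add_smul_le hσ hI x le_rfl).trans_lt hq) ?_ hfin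
  intro γ t v hU hv
  refine ⟨y • v, (hv.const_smul y).const_add _, ?_⟩
  have hσ := hU.self_of_nhds
  obtain ⟨h0, h1⟩ := inner_eq_zero_of_mem_imSphere hU hv
  rw [gNorm_of_orthogonal (by simp [h0]), norm_smul, Real.norm_of_nonneg hy,
    norm_one_sub_sq_coe_add_smul hσ hI, div_mul_eq_mul_div]
  -- The relation obtained carries the factor `y`, so it also covers `y = 0`, where `unitOf` takes
  -- its default value.
  have h2 := inner_im_eq ((x : ℍ[ℝ]) + y • γ t) v
  rw [norm_im_coe_add_smul hσ x hy, im_coe_add_smul hσ, real_inner_smul_left, h1, mul_zero] at h2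
  rw [real_inner_smul_right, ← h2]

/-! ### Smoothed projection onto a slice -/

/-- A smooth approximation of the absolute value from below. -/
def softAbs (e y : ℝ) : ℝ := √(y ^ 2 + e ^ 2) - e

theorem softAbs_nonneg (e y : ℝ) : 0 ≤ softAbs e y :=
  sub_nonneg.2 (Real.le_sqrt_of_sq_le (by nlinarith [sq_nonneg y]))

theorem softAbs_le {e y : ℝ} (he : 0 ≤ e) (hy : 0 ≤ y) : softAbs e y ≤ y := by
  rw [softAbs, sub_le_iff_le_add, Real.sqrt_le_left (by positivity)]
  nlinarith [mul_nonneg he hy]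

theorem le_softAbs_add {e : ℝ} (y : ℝ) : y ≤ softAbs e y + e := by
  rw [softAbs, sub_add_cancel]
  exact Real.le_sqrt_of_sq_le (by nlinarith [sq_nonneg e])

/-- A smooth approximation of the projection `sliceProj I`. -/
def softProj (e : ℝ) (I q : ℍ[ℝ]) : ℍ[ℝ] := (q.re : ℍ[ℝ]) + softAbs e ‖q.im‖ • I

theorem contDiff_softProj {e : ℝ} (he : 0 < e) (I : ℍ[ℝ]) : ContDiff ℝ 1 (softProj e I) := by
  have h : softProj e I = fun q => reL q • (1 : ℍ[ℝ]) + (√(‖imL q‖ ^ 2 + e ^ 2) - e) • I := by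
    ext1 q; simp [softProj, softAbs, coe_eq_smul_one]
  rw [h]
  refine (reL.contDiff.smul contDiff_const).add ((ContDiff.sub ?_ contDiff_const).fun_smul
    contDiff_const)
  refine ContDiff.sqrt ((imL.contDiff.norm_sq ℝ).add contDiff_const) fun q => ?_
  positivity

/-- This is what subtracting `e` in `softAbs` achieves: points do not move away from the origin, so
the image stays in the ball and the factor 1/(1 - |z|²) does not grow. -/
theorem norm_softProj_le {e : ℝ} (he : 0 ≤ e) {I : ℍ[ℝ]} (hI : I ∈ imSphere) (q : ℍ[ℝ]) :
    ‖softProj e I q‖ ≤ ‖q‖ := by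
  refine (abs_le_of_sq_le_sq' ?_ (norm_nonneg _)).2
  rw [softProj, norm_sq_coe_add_smul hI, norm_sq_eq_re_im]
  gcongr
  · exact softAbs_nonneg _ _
  · exact softAbs_le he (norm_nonneg _)

theorem hasDerivAt_softProj {e : ℝ} (he : 0 < e) (I : ℍ[ℝ]) {γ : ℝ → ℍ[ℝ]} {t : ℝ} {v : ℍ[ℝ]}
    (hv : HasDerivAt γ v t) :
    HasDerivAt (fun s => softProj e I (γ s))
      ((v.re : ℍ[ℝ]) + (inner ℝ (γ t).im v / √(‖(γ t).im‖ ^ 2 + e ^ 2)) • I) t := by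
  have h : (fun s => softProj e I (γ s)) =
      fun s => reL (γ s) • (1 : ℍ[ℝ]) + (√(‖imL (γ s)‖ ^ 2 + e ^ 2) - e) • I := by
    ext1 q; simp [softProj, softAbs, coe_eq_smul_one]
  have h1 : HasDerivAt (fun s => reL (γ s)) v.re t := reL.hasFDerivAt.comp_hasDerivAt t hv
  have h2 : HasDerivAt (fun s => imL (γ s)) v.im t := imL.hasFDerivAt.comp_hasDerivAt t hv
  have h3 := ((h2.norm_sq.add_const (e ^ 2)).sqrt (by positivity)).sub_const e
  rw [h]
  refine ((h1.smul_const (1 : ℍ[ℝ])).add (h3.smul_const I)).congr_deriv ?_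
  rw [coe_eq_smul_one, imL_apply, inner_im, mul_div_mul_left _ _ two_ne_zero]

/-- With y = |Im γ|, the I-component of the new velocity is that of v along `unitOf (γ t)` times
y/√(y² + e²) ≤ 1. The new velocity is thus no longer than the slice component of v. -/
theorem hypEDist_softProj_le {e : ℝ} (he : 0 < e) {I : ℍ[ℝ]} (hI : I ∈ imSphere) {p q : ℍ[ℝ]}
    (hfin : elengthDist unitBall gNorm p q ≠ ⊤) :
    elengthDist (unitBall ∩ (slice I : Set ℍ[ℝ])) hypNorm (softProj e I p) (softProj e I q) ≤
      elengthDist unitBall gNorm p q := by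
  have := elengthDist_comp_le (U := unitBall) (U' := unitBall ∩ (slice I : Set ℍ[ℝ])) (N' := hypNorm)
    zero_le_one (contDiff_softProj he I).contDiffOn (fun z hz => ⟨(norm_softProj_le he.le hI z).trans_lt hz,
      coe_add_smul_mem_slice I _ _⟩) ?_ hfin
  · simpa using this
  · intro γ t v hU hv
    refine ⟨_, hasDerivAt_softProj he I hv, ?_⟩
    have ht := hU.self_of_nhds
    rw [one_mul]
    refine le_trans ?_ (norm_tangentPart_le (γ t) v)
    have h1 := one_sub_norm_sq_pos ht
    have h2 := norm_softProj_le he.le hI (γ t)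
    unfold hypNorm
    gcongr
    refine (abs_le_of_sq_le_sq' ?_ (norm_nonneg _)).2
    rw [norm_sq_coe_add_smul hI, norm_sq_tangentPart, inner_im_eq, div_pow,
      Real.sq_sqrt (by positivity), mul_pow]
    gcongr
    rw [div_le_iff₀ (by positivity), mul_comm]
    gcongr
    nlinarith [sq_nonneg e]

/-- Segments bound the hyperbolic distance. -/
theorem hypEDist_le {I p q : ℍ[ℝ]} {r : ℝ} (hr : r < 1) (hp : ‖p‖ ≤ r) (hq : ‖q‖ ≤ r)
    (hpI : p ∈ slice I) (hqI : q ∈ slice I) :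
    elengthDist (unitBall ∩ (slice I : Set ℍ[ℝ])) hypNorm p q ≤
      ENNReal.ofReal (‖q - p‖ / (1 - r ^ 2)) := by
  have hr0 : 0 ≤ r := (norm_nonneg p).trans hp
  set γ : ℝ → ℍ[ℝ] := fun t => p + t • (q - p) with hγ
  have hd : ∀ t, HasDerivAt γ (q - p) t := fun t => by
    exact (((hasDerivAt_id t).smul_const (q - p)).const_add p).congr_deriv (one_smul _ _)
  have hb : ∀ t ∈ Icc (0 : ℝ) 1, ‖γ t‖ ≤ r := by
    intro t ht
    have h : γ t = (1 - t) • p + t • q := by simp only [hγ]; module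
    rw [h]
    have := convex_closedBall (0 : ℍ[ℝ]) r (x := p) (by simpa using hp) (y := q) (by simpa using hq)
      (sub_nonneg.2 ht.2) ht.1 (by ring)
    simpa using this
  have h := elengthDist_le (U := unitBall ∩ (slice I : Set ℍ[ℝ])) (N := hypNorm) zero_le_one
    (isPiecewiseC1_of_contDiff (γ := γ) (by fun_prop) zero_le_one)
    (fun t ht => ⟨(hb t ht).trans_lt hr,
      add_mem hpI (Submodule.smul_mem _ _ (sub_mem hqI hpI))⟩)
  simp only [hγ, zero_smul, add_zero, one_smul, add_sub_cancel] at h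
  refine h.trans ?_
  unfold curveLength
  refine (setLIntegral_mono_ae' (g := fun _ => ENNReal.ofReal (‖q - p‖ / (1 - r ^ 2)))
    measurableSet_Icc (Eventually.of_forall fun t ht => ?_)).trans ?_
  · refine ENNReal.ofReal_le_ofReal ?_
    rw [(hd t).deriv]
    have h1 : 0 < 1 - r ^ 2 := by nlinarith
    have h2 := hb t ht
    unfold hypNorm
    gcongr
  · simp

/-! ### The Lipschitz map Im q / |1 - q²| -/

/-- The map `q ↦ Im q / |1 - q²|`. -/
def imRatio (q : ℍ[ℝ]) : ℍ[ℝ] := (√((1 - ‖q‖ ^ 2) ^ 2 + 4 * ‖q.im‖ ^ 2))⁻¹ • q.im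

theorem imRatio_eq (q : ℍ[ℝ]) : imRatio q = ‖1 - q ^ 2‖⁻¹ • q.im := by
  rw [imRatio, ← norm_one_sub_sq, Real.sqrt_sq (norm_nonneg _)]

theorem imRatio_radicand_pos {q : ℍ[ℝ]} (hq : q ∈ unitBall) :
    0 < (1 - ‖q‖ ^ 2) ^ 2 + 4 * ‖q.im‖ ^ 2 := by
  have := one_sub_norm_sq_pos hq
  positivity

theorem contDiffOn_imRatio : ContDiffOn ℝ 1 imRatio unitBall := by
  have h1 : ContDiff ℝ 1 fun q : ℍ[ℝ] => (1 - ‖q‖ ^ 2) ^ 2 + 4 * ‖imL q‖ ^ 2 :=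
    ((contDiff_const.sub (contDiff_id.norm_sq ℝ)).pow 2).add
      (contDiff_const.mul (imL.contDiff.norm_sq ℝ))
  refine ContDiffOn.smul (ContDiffOn.inv (h1.contDiffOn.sqrt ?_) ?_) imL.contDiff.contDiffOn
  · exact fun q hq => (imRatio_radicand_pos hq).ne'
  · exact fun q hq => (Real.sqrt_pos.2 (imRatio_radicand_pos hq)).ne'

theorem hasDerivAt_imRatio {γ : ℝ → ℍ[ℝ]} {t : ℝ} {v : ℍ[ℝ]} (hv : HasDerivAt γ v t)
    (ht : γ t ∈ unitBall) :
    HasDerivAt (fun s => imRatio (γ s))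
      (‖1 - γ t ^ 2‖⁻¹ • v.im - ((4 * inner ℝ (γ t).im v - 2 * (1 - ‖γ t‖ ^ 2) * inner ℝ (γ t) v) /
        ‖1 - γ t ^ 2‖ ^ 3) • (γ t).im) t := by
  have h2 : HasDerivAt (fun s => imL (γ s)) v.im t := imL.hasFDerivAt.comp_hasDerivAt t hv
  have hpos := imRatio_radicand_pos ht
  have h3 := (((((hv.norm_sq).const_sub 1).pow 2).add (h2.norm_sq.const_mul 4)).sqrt hpos.ne').inv
    (Real.sqrt_pos.2 hpos).ne'
  refine (h3.smul h2).congr_deriv ?_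
  have hR := norm_one_sub_sq_pos ht
  simp only [imL_apply, Pi.add_apply, Pi.pow_apply, Pi.inv_apply]
  rw [← norm_one_sub_sq, Real.sqrt_sq (norm_nonneg _), inner_im, sub_eq_add_neg (_ • _) (_ • _), ← neg_smul]
  congr 2
  field_simp
  ring

/-- The first term is at most (T + S)/R. In the second, the inner products are controlled by T
alone, which gives at most 2T/R. As R ≥ A, both T/R and S/R are at most `gNorm w v`, whence 3 + 1 =
4. -/
theorem norm_deriv_imRatio_le {w : ℍ[ℝ]} (hw : w ∈ unitBall) (v : ℍ[ℝ]) :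
    ‖‖1 - w ^ 2‖⁻¹ • v.im - ((4 * inner ℝ w.im v - 2 * (1 - ‖w‖ ^ 2) * inner ℝ w v) /
        ‖1 - w ^ 2‖ ^ 3) • w.im‖ ≤ 4 * gNorm w v := by
  have hA := one_sub_norm_sq_pos hw
  have hAR := one_sub_norm_sq_le w
  have hR := norm_one_sub_sq_pos hw
  have hR2 := norm_one_sub_sq w
  have hw1 : ‖w‖ ≤ 1 := le_of_lt hw
  set A := 1 - ‖w‖ ^ 2
  set R := ‖1 - w ^ 2‖
  set b := ‖w.im‖
  set T := ‖tangentPart w v‖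
  set S := ‖v - tangentPart w v‖
  have hb : 0 ≤ b := norm_nonneg _
  have hT : 0 ≤ T := norm_nonneg _
  have h1 : T / R ≤ gNorm w v :=
    (div_le_div_of_nonneg_left hT hA hAR).trans (norm_tangentPart_le w v)
  have h2 : S / R ≤ gNorm w v := norm_sub_tangentPart_le w v
  have him : ‖v.im‖ ≤ T + S := by
    have h3 : ‖v.im‖ ≤ ‖v‖ := by
      refine (abs_le_of_sq_le_sq' ?_ (norm_nonneg _)).2
      rw [norm_sq_eq_re_im v]; nlinarith [sq_nonneg v.re]
    refine h3.trans ?_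
    calc ‖v‖ = ‖tangentPart w v + (v - tangentPart w v)‖ := by congr 1; abel
      _ ≤ _ := norm_add_le _ _
  have hi1 : |inner ℝ w.im v| ≤ b * T := abs_inner_im_le w v
  have hi2 : |inner ℝ w v| ≤ T := (abs_inner_le w v).trans (mul_le_of_le_one_left hT hw1)
  have hnum : |4 * inner ℝ w.im v - 2 * A * inner ℝ w v| ≤ (4 * b + 2 * A) * T := by
    rw [abs_le] at hi1 hi2 ⊢
    constructor <;> nlinarith
  have hmain : (4 * b + 2 * A) * T / R ^ 3 * b ≤ 2 * (T / R) := by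
    have : (4 * b + 2 * A) * T / R ^ 3 * b = ((4 * b + 2 * A) * b) * T / R ^ 3 := by ring
    rw [this, ← mul_div_assoc, div_le_div_iff₀ (by positivity) hR]
    -- Here 2R² = 2A² + 8b², and 2Ab ≤ A² + b².
    have h5 : (4 * b + 2 * A) * b ≤ 2 * R ^ 2 := by
      rw [hR2]; nlinarith [sq_nonneg (A - b)]
    calc (4 * b + 2 * A) * b * T * R ≤ 2 * R ^ 2 * T * R := by gcongr
      _ = 2 * T * R ^ 3 := by ring
  refine (norm_sub_le _ _).trans ?_
  rw [norm_smul, norm_smul, norm_inv, norm_norm, norm_div, norm_pow, norm_norm, Real.norm_eq_abs]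
  have h6 : R⁻¹ * ‖v.im‖ ≤ T / R + S / R := by
    rw [← add_div, div_eq_inv_mul]; gcongr
  have h7 : |4 * inner ℝ w.im v - 2 * A * inner ℝ w v| / R ^ 3 * b ≤ 2 * (T / R) := by
    refine le_trans ?_ hmain
    gcongr
  linarith

theorem enorm_imRatio_sub_le {p q : ℍ[ℝ]} (hfin : elengthDist unitBall gNorm p q ≠ ⊤) :
    ‖imRatio q - imRatio p‖ₑ ≤ ENNReal.ofReal 4 * elengthDist unitBall gNorm p q := by
  refine (enorm_sub_le_elengthDist univ _ _).trans ?_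
  refine elengthDist_comp_le (by norm_num) contDiffOn_imRatio (fun _ _ => mem_univ _) ?_ hfin
  intro γ t v hU hv
  exact ⟨_, hasDerivAt_imRatio hv hU.self_of_nhds, norm_deriv_imRatio_le hU.self_of_nhds v⟩

/-! ### Arcs and chords on the sphere of units -/

theorem exists_mem_imSphere_orthogonal (I : ℍ[ℝ]) :
    ∃ J ∈ imSphere, inner ℝ I J = 0 := by
  by_cases h : I.imI = 0 ∧ I.imJ = 0
  · refine ⟨unitI, unitI_mem_imSphere, ?_⟩
    rw [inner_eq]; simp [unitI, h.1]
  · set K : ℍ[ℝ] := ⟨0, -I.imJ, I.imI, 0⟩ with hK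
    have hK0 : K ≠ 0 := by
      intro h0
      refine h ⟨?_, ?_⟩
      · simpa [hK] using congrArg (·.imJ) h0
      · simpa [hK] using congrArg (·.imI) h0
    refine ⟨‖K‖⁻¹ • K, ⟨by rw [Quaternion.re_smul, show K.re = 0 from rfl, smul_zero], ?_⟩, ?_⟩
    · rw [norm_smul, norm_inv, norm_norm, inv_mul_cancel₀ (norm_ne_zero_iff.2 hK0)]
    · rw [real_inner_smul_right, inner_eq]
      simp [hK]; right; ring

theorem exists_eq_cos_smul_add_sin_smul {I J : ℍ[ℝ]} (hI : I ∈ imSphere) (hJ : J ∈ imSphere) :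
    ∃ (K : ℍ[ℝ]) (θ : ℝ), K ∈ imSphere ∧ inner ℝ I K = 0 ∧ 0 ≤ θ ∧
      θ ≤ Real.pi / 2 * ‖I - J‖ ∧ J = Real.cos θ • I + Real.sin θ • K := by
  set c : ℝ := inner ℝ I J with hc
  have hc1 : |c| ≤ 1 := by
    have := abs_real_inner_le_norm I J
    rwa [hI.2, hJ.2, one_mul] at this
  obtain ⟨hcl, hcu⟩ := abs_le.1 hc1
  have hII : inner ℝ I I = 1 := by rw [real_inner_self_eq_norm_sq, hI.2, one_pow]
  have hdist : ‖I - J‖ ^ 2 = 2 - 2 * c := by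
    rw [norm_sub_sq_real, hI.2, hJ.2]; ring
  have hrej : ‖J - c • I‖ ^ 2 = 1 - c ^ 2 := by
    rw [norm_sub_sq_real, real_inner_smul_right, real_inner_comm, norm_smul, hI.2, hJ.2,
      ← hc, mul_one, Real.norm_eq_abs, sq_abs]; ring
  have hs : √(1 - c ^ 2) = ‖J - c • I‖ := by rw [← hrej, Real.sqrt_sq (norm_nonneg _)]
  have hθ : Real.arccos c ≤ Real.pi / 2 * ‖I - J‖ := by
    set θ := Real.arccos c with hθ
    have h0 : 0 ≤ θ := Real.arccos_nonneg c
    have hpi : θ ≤ Real.pi := Real.arccos_le_pi c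
    -- The chord is 2 sin(θ/2), and Jordan's inequality sin t ≥ 2t/π on [0, π/2] yields the constant
    -- π/2.
    have h1 := Real.mul_le_sin (x := θ / 2) (by linarith) (by linarith)
    have h2 : ‖I - J‖ = 2 * Real.sin (θ / 2) := by
      have hsin : 0 ≤ Real.sin (θ / 2) :=
        Real.sin_nonneg_of_nonneg_of_le_pi (by linarith) (by linarith)
      rw [← sq_eq_sq₀ (norm_nonneg _) (by positivity), hdist, mul_pow, Real.sin_sq_eq_half_sub,
        mul_div_cancel₀ _ two_ne_zero, hθ, Real.cos_arccos hcl hcu]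
      ring
    have hpos := Real.pi_pos
    rw [h2]
    calc θ = Real.pi / 2 * (2 * (2 / Real.pi * (θ / 2))) := by field_simp
      _ ≤ _ := by gcongr
  -- Here J = ±I does not determine a great circle, and any unit orthogonal to I serves.
  by_cases h : J - c • I = 0
  · obtain ⟨K, hK, hIK⟩ := exists_mem_imSphere_orthogonal I
    refine ⟨K, Real.arccos c, hK, hIK, Real.arccos_nonneg c, hθ, ?_⟩
    rw [Real.cos_arccos hcl hcu, Real.sin_arccos, hs, h, norm_zero, zero_smul, add_zero]
    exact sub_eq_zero.1 h
  · have hn := norm_ne_zero_iff.2 h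
    refine ⟨‖J - c • I‖⁻¹ • (J - c • I), Real.arccos c, ⟨by simp [hI.1, hJ.1], ?_⟩, ?_,
      Real.arccos_nonneg c, hθ, ?_⟩
    · rw [norm_smul, norm_inv, norm_norm, inv_mul_cancel₀ hn]
    · rw [real_inner_smul_right, inner_sub_right, real_inner_smul_right, hII, ← hc]; ring
    · rw [Real.cos_arccos hcl hcu, Real.sin_arccos, hs, smul_smul, mul_inv_cancel₀ hn]
      module

theorem norm_cos_smul_add_sin_smul {I K : ℍ[ℝ]} (hI : ‖I‖ = 1) (hK : ‖K‖ = 1)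
    (h : inner ℝ I K = 0) (t : ℝ) : ‖Real.cos t • I + Real.sin t • K‖ = 1 := by
  rw [← sq_eq_sq₀ (norm_nonneg _) zero_le_one, norm_add_sq_real, real_inner_smul_left,
    real_inner_smul_right, h, norm_smul, norm_smul, hI, hK]
  simp

/-- Arcs of great circles bound the spherical distance. -/
theorem sphereEDist_le {I J : ℍ[ℝ]} (hI : I ∈ imSphere) (hJ : J ∈ imSphere) :
    elengthDist imSphere (fun _ v => ‖v‖) I J ≤ ENNReal.ofReal (Real.pi / 2 * ‖I - J‖) := by
  obtain ⟨K, θ, hK, hIK, hθ, hle, hJe⟩ := exists_eq_cos_smul_add_sin_smul hI hJ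
  set γ : ℝ → ℍ[ℝ] := fun t => Real.cos t • I + Real.sin t • K with hγ
  have hd : ∀ t, HasDerivAt γ (Real.cos t • K + Real.sin t • (-I)) t := fun t => by
    refine (((Real.hasDerivAt_cos t).smul_const I).add
      ((Real.hasDerivAt_sin t).smul_const K)).congr_deriv ?_
    module
  have h := elengthDist_le (U := imSphere) (N := fun _ v => ‖v‖) hθ
    (isPiecewiseC1_of_contDiff (γ := γ) (by fun_prop) hθ)
    (fun t _ => ⟨by simp [hγ, hI.1, hK.1], norm_cos_smul_add_sin_smul hI.2 hK.2 hIK t⟩)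
  have h0 : γ 0 = I := by simp [hγ]
  have h1 : γ θ = J := hJe.symm
  rw [h0, h1] at h
  refine h.trans ((le_of_eq ?_).trans (ENNReal.ofReal_le_ofReal hle))
  unfold curveLength
  have hn : ∀ t, ‖deriv γ t‖ = 1 := fun t => by
    rw [(hd t).deriv]
    exact norm_cos_smul_add_sin_smul hK.2 (by rw [norm_neg, hI.2])
      (by rw [inner_neg_right, real_inner_comm, hIK, neg_zero]) t
  simp [hn]

/-- For unit vectors |rI - sJ|² = (r - s)² + rs|I - J|², and rs ≥ min(r, s)². -/
theorem min_mul_norm_sub_le {I J : ℍ[ℝ]} (hI : I ∈ imSphere) (hJ : J ∈ imSphere) {r s : ℝ}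
    (hr : 0 ≤ r) (hs : 0 ≤ s) : min r s * ‖I - J‖ ≤ ‖r • I - s • J‖ := by
  refine (abs_le_of_sq_le_sq' ?_ (norm_nonneg _)).2
  have hc := (le_abs_self _).trans (abs_real_inner_le_norm I J)
  rw [hI.2, hJ.2, one_mul] at hc
  rw [mul_pow, norm_sub_sq_real, norm_sub_sq_real, real_inner_smul_left, real_inner_smul_right,
    norm_smul, norm_smul, hI.2, hJ.2, mul_one, mul_one, Real.norm_of_nonneg hr,
    Real.norm_of_nonneg hs]
  rcases le_total r s with h | h
  · rw [min_eq_left h]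
    nlinarith [mul_nonneg (mul_nonneg hr (sub_nonneg.2 h)) (sub_nonneg.2 hc), sq_nonneg (s - r)]
  · rw [min_eq_right h]
    nlinarith [mul_nonneg (mul_nonneg hs (sub_nonneg.2 h)) (sub_nonneg.2 hc), sq_nonneg (s - r)]

/-! ### The two bounds -/

theorem sliceProj_coe_add_smul {I : ℍ[ℝ]} (hI : I ∈ imSphere) (I₀ : ℍ[ℝ]) (x : ℝ) {y : ℝ}
    (hy : 0 ≤ y) : sliceProj I₀ ((x : ℍ[ℝ]) + y • I) = (x : ℍ[ℝ]) + y • I₀ := by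
  rw [sliceProj, re_coe_add_smul hI, norm_im_coe_add_smul hI x hy]

theorem imRatio_coe_add_smul {I : ℍ[ℝ]} (hI : I ∈ imSphere) (x y : ℝ) :
    imRatio ((x : ℍ[ℝ]) + y • I) = (y / ‖1 - ((x : ℍ[ℝ]) + y • I) ^ 2‖) • I := by
  rw [imRatio_eq, im_coe_add_smul hI, smul_smul, div_eq_inv_mul]

theorem hypEDist_ne_top {I p q : ℍ[ℝ]} (hp : p ∈ unitBall ∩ (slice I : Set ℍ[ℝ]))
    (hq : q ∈ unitBall ∩ (slice I : Set ℍ[ℝ])) :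
    elengthDist (unitBall ∩ (slice I : Set ℍ[ℝ])) hypNorm p q ≠ ⊤ :=
  ne_top_of_le_ne_top ENNReal.ofReal_ne_top
    (hypEDist_le (max_lt hp.1 hq.1) (le_max_left _ _) (le_max_right _ _) hp.2 hq.2)

theorem sphereEDist_ne_top {I J : ℍ[ℝ]} (hI : I ∈ imSphere) (hJ : J ∈ imSphere) :
    elengthDist imSphere (fun _ v => ‖v‖) I J ≠ ⊤ :=
  ne_top_of_le_ne_top ENNReal.ofReal_ne_top (sphereEDist_le hI hJ)

theorem coe_add_smul_mem_unitBall {I J : ℍ[ℝ]} (hI : I ∈ imSphere) (hJ : J ∈ imSphere) {x y : ℝ}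
    (h : (x : ℍ[ℝ]) + y • I ∈ unitBall) : (x : ℍ[ℝ]) + y • J ∈ unitBall :=
  (norm_coe_add_smul_le hJ hI x le_rfl).trans_lt h

/-- Moving within a slice. -/
theorem gEDist_slice_le {I₀ I : ℍ[ℝ]} (hI₀ : I₀ ∈ imSphere) (hI : I ∈ imSphere) {x₁ y₁ x₂ y₂ : ℝ}
    (h₁ : (x₁ : ℍ[ℝ]) + y₁ • I₀ ∈ unitBall) (h₂ : (x₂ : ℍ[ℝ]) + y₂ • I₀ ∈ unitBall) :
    elengthDist unitBall gNorm ((x₁ : ℍ[ℝ]) + y₁ • I) ((x₂ : ℍ[ℝ]) + y₂ • I) ≤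
      elengthDist (unitBall ∩ (slice I₀ : Set ℍ[ℝ])) hypNorm
        ((x₁ : ℍ[ℝ]) + y₁ • I₀) ((x₂ : ℍ[ℝ]) + y₂ • I₀) := by
  have := gEDist_sliceMap_le hI₀ hI (hypEDist_ne_top ⟨h₁, coe_add_smul_mem_slice I₀ x₁ y₁⟩
    ⟨h₂, coe_add_smul_mem_slice I₀ x₂ y₂⟩)
  rwa [sliceMap_coe_add_smul hI₀, sliceMap_coe_add_smul hI₀] at this

/-- The rotation takes place at the endpoint attaining the minimum: either rotate first and then
move in the slice of I₂, or move in the slice of I₁ and rotate last. -/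
theorem gEDist_le {I₀ I₁ I₂ : ℍ[ℝ]} (hI₀ : I₀ ∈ imSphere) (hI₁ : I₁ ∈ imSphere)
    (hI₂ : I₂ ∈ imSphere) {x₁ y₁ x₂ y₂ : ℝ} (hy₁ : 0 ≤ y₁) (hy₂ : 0 ≤ y₂)
    (h₁ : (x₁ : ℍ[ℝ]) + y₁ • I₁ ∈ unitBall) (h₂ : (x₂ : ℍ[ℝ]) + y₂ • I₂ ∈ unitBall) :
    elengthDist unitBall gNorm ((x₁ : ℍ[ℝ]) + y₁ • I₁) ((x₂ : ℍ[ℝ]) + y₂ • I₂) ≤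
      elengthDist (unitBall ∩ (slice I₀ : Set ℍ[ℝ])) hypNorm
        ((x₁ : ℍ[ℝ]) + y₁ • I₀) ((x₂ : ℍ[ℝ]) + y₂ • I₀) +
      ENNReal.ofReal (min (y₁ / ‖1 - ((x₁ : ℍ[ℝ]) + y₁ • I₁) ^ 2‖)
        (y₂ / ‖1 - ((x₂ : ℍ[ℝ]) + y₂ • I₂) ^ 2‖)) *
        elengthDist imSphere (fun _ v => ‖v‖) I₁ I₂ := by
  have h₁' := coe_add_smul_mem_unitBall hI₁ hI₀ h₁
  have h₂' := coe_add_smul_mem_unitBall hI₂ hI₀ h₂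
  have hS := sphereEDist_ne_top hI₁ hI₂
  rcases min_cases (y₁ / ‖1 - ((x₁ : ℍ[ℝ]) + y₁ • I₁) ^ 2‖)
    (y₂ / ‖1 - ((x₂ : ℍ[ℝ]) + y₂ • I₂) ^ 2‖) with ⟨hm, -⟩ | ⟨hm, -⟩ <;> rw [hm]
  · refine le_of_le_of_eq ?_ (add_comm _ _)
    exact (elengthDist_triangle _ _ _ ((x₁ : ℍ[ℝ]) + y₁ • I₂) _).trans
      (add_le_add (gEDist_rotate_le hy₁ hI₁ h₁ hS) (gEDist_slice_le hI₀ hI₂ h₁' h₂'))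
  · rw [norm_one_sub_sq_coe_add_smul hI₂ hI₁]
    exact (elengthDist_triangle _ _ _ ((x₂ : ℍ[ℝ]) + y₂ • I₁) _).trans
      (add_le_add (gEDist_slice_le hI₀ hI₁ h₁' h₂')
        (gEDist_rotate_le hy₂ hI₁ (coe_add_smul_mem_unitBall hI₂ hI₁ h₂) hS))

/-- The projection is close to its smooth approximation, in the hyperbolic distance. -/
theorem hypEDist_sliceProj_softProj_le {I q : ℍ[ℝ]} (hI : I ∈ imSphere) (hq : q ∈ unitBall)
    {e : ℝ} (he : 0 < e) :
    elengthDist (unitBall ∩ (slice I : Set ℍ[ℝ])) hypNorm (sliceProj I q) (softProj e I q) ≤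
        ENNReal.ofReal (e / (1 - ‖q‖ ^ 2)) ∧
    elengthDist (unitBall ∩ (slice I : Set ℍ[ℝ])) hypNorm (softProj e I q) (sliceProj I q) ≤
        ENNReal.ofReal (e / (1 - ‖q‖ ^ 2)) := by
  have h1 : ‖sliceProj I q‖ ≤ ‖q‖ := by
    refine (abs_le_of_sq_le_sq' ?_ (norm_nonneg _)).2
    rw [sliceProj, norm_sq_coe_add_smul hI, ← norm_sq_eq_re_im]
  have h2 := norm_softProj_le he.le hI q
  have h3 : sliceProj I q ∈ slice I := coe_add_smul_mem_slice I _ _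
  have h4 : softProj e I q ∈ slice I := coe_add_smul_mem_slice I _ _
  have h5 : ‖softProj e I q - sliceProj I q‖ ≤ e := by
    rw [softProj, sliceProj, add_sub_add_left_eq_sub, ← sub_smul, norm_smul, hI.2, mul_one,
      Real.norm_eq_abs, abs_le]
    have := softAbs_le he.le (norm_nonneg q.im)
    have := le_softAbs_add (e := e) ‖q.im‖
    constructor <;> linarith
  have h6 := one_sub_norm_sq_pos hq
  refine ⟨(hypEDist_le hq h1 h2 h3 h4).trans (ENNReal.ofReal_le_ofReal ?_),
    (hypEDist_le hq h2 h1 h4 h3).trans (ENNReal.ofReal_le_ofReal ?_)⟩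
  · gcongr
  · rw [norm_sub_rev]; gcongr

/-- Replacing π by `softProj` costs an arbitrarily small error at each endpoint. -/
theorem hypEDist_sliceProj_le {I p q : ℍ[ℝ]} (hI : I ∈ imSphere) (hp : p ∈ unitBall)
    (hq : q ∈ unitBall) (hfin : elengthDist unitBall gNorm p q ≠ ⊤) :
    elengthDist (unitBall ∩ (slice I : Set ℍ[ℝ])) hypNorm (sliceProj I p) (sliceProj I q) ≤
      elengthDist unitBall gNorm p q := by
  have hp0 := one_sub_norm_sq_pos hp
  have hq0 := one_sub_norm_sq_pos hq
  set k : ℝ := 1 / (1 - ‖p‖ ^ 2) + 1 / (1 - ‖q‖ ^ 2) with hk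
  have hk0 : 0 < k := by positivity
  refine ENNReal.le_of_forall_pos_le_add fun ε hε _ => ?_
  -- With smoothing parameter ε/k, the errors at p and q add up to exactly ε.
  have he : 0 < (ε : ℝ) / k := div_pos hε hk0
  calc _ ≤ _ := elengthDist_triangle _ _ _ (softProj (ε / k) I p) _
    _ ≤ _ := add_le_add_right (elengthDist_triangle _ _ _ (softProj (ε / k) I q) _) _
    _ ≤ ENNReal.ofReal (ε / k / (1 - ‖p‖ ^ 2)) + (elengthDist unitBall gNorm p q +
        ENNReal.ofReal (ε / k / (1 - ‖q‖ ^ 2))) :=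
      add_le_add (hypEDist_sliceProj_softProj_le hI hp he).1
        (add_le_add (hypEDist_softProj_le he hI hfin) (hypEDist_sliceProj_softProj_le hI hq he).2)
    _ = elengthDist unitBall gNorm p q + (ENNReal.ofReal (ε / k / (1 - ‖p‖ ^ 2)) +
        ENNReal.ofReal (ε / k / (1 - ‖q‖ ^ 2))) := by ring
    _ = elengthDist unitBall gNorm p q + ε := by
      rw [← ENNReal.ofReal_add (by positivity) (by positivity)]
      have : (ε : ℝ) / k / (1 - ‖p‖ ^ 2) + ε / k / (1 - ‖q‖ ^ 2) = ε := by
        calc _ = (ε : ℝ) / k * k := by rw [hk]; ring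
          _ = ε := div_mul_cancel₀ _ hk0.ne'
      rw [this, ENNReal.ofReal_coe_nnreal]

theorem min_mul_sphereDist_le {I₁ I₂ : ℍ[ℝ]} (hI₁ : I₁ ∈ imSphere)
    (hI₂ : I₂ ∈ imSphere) {x₁ y₁ x₂ y₂ : ℝ} (hy₁ : 0 ≤ y₁) (hy₂ : 0 ≤ y₂)
    (hfin : elengthDist unitBall gNorm ((x₁ : ℍ[ℝ]) + y₁ • I₁) ((x₂ : ℍ[ℝ]) + y₂ • I₂) ≠ ⊤) :
    min (y₁ / ‖1 - ((x₁ : ℍ[ℝ]) + y₁ • I₁) ^ 2‖) (y₂ / ‖1 - ((x₂ : ℍ[ℝ]) + y₂ • I₂) ^ 2‖) *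
        sphereDist I₁ I₂ ≤
      2 * Real.pi * gDist ((x₁ : ℍ[ℝ]) + y₁ • I₁) ((x₂ : ℍ[ℝ]) + y₂ • I₂) := by
  have hS : sphereDist I₁ I₂ ≤ Real.pi / 2 * ‖I₁ - I₂‖ :=
    ENNReal.toReal_le_of_le_ofReal (by positivity) (sphereEDist_le hI₁ hI₂)
  have hV := ENNReal.toReal_mono (ENNReal.mul_ne_top ENNReal.ofReal_ne_top hfin)
    (enorm_imRatio_sub_le hfin)
  rw [toReal_enorm, ENNReal.toReal_mul, ENNReal.toReal_ofReal (by norm_num),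
    ← lengthDist_eq_toReal, imRatio_coe_add_smul hI₁, imRatio_coe_add_smul hI₂, norm_sub_rev] at hV
  have hm := min_mul_norm_sub_le hI₁ hI₂
    (r := y₁ / ‖1 - ((x₁ : ℍ[ℝ]) + y₁ • I₁) ^ 2‖) (s := y₂ / ‖1 - ((x₂ : ℍ[ℝ]) + y₂ • I₂) ^ 2‖)
    (by positivity) (by positivity)
  set m := min (y₁ / ‖1 - ((x₁ : ℍ[ℝ]) + y₁ • I₁) ^ 2‖) (y₂ / ‖1 - ((x₂ : ℍ[ℝ]) + y₂ • I₂) ^ 2‖)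
  have hm0 : 0 ≤ m := le_min (by positivity) (by positivity)
  calc m * sphereDist I₁ I₂ ≤ m * (Real.pi / 2 * ‖I₁ - I₂‖) := by gcongr
    _ = Real.pi / 2 * (m * ‖I₁ - I₂‖) := by ring
    -- The factor 4 is the Lipschitz constant of `imRatio`, and π/2 compares arc with chord.
    _ ≤ Real.pi / 2 * (4 * gDist ((x₁ : ℍ[ℝ]) + y₁ • I₁) ((x₂ : ℍ[ℝ]) + y₂ • I₂)) :=
      mul_le_mul_of_nonneg_left (hm.trans hV) (by positivity)
    _ = _ := by ring

end QuatBall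

end

theorem mainTheorem5 :
    ∃ c C : ℝ, 0 < c ∧ 0 < C ∧
      ∀ I₀ ∈ QuatBall.imSphere,
      ∀ q₁ ∈ QuatBall.unitBall, ∀ q₂ ∈ QuatBall.unitBall,
      ∀ x₁ y₁ x₂ y₂ : ℝ, 0 ≤ y₁ → 0 ≤ y₂ →
      ∀ I₁ ∈ QuatBall.imSphere, ∀ I₂ ∈ QuatBall.imSphere,
        q₁ = (x₁ : ℍ[ℝ]) + y₁ • I₁ → q₂ = (x₂ : ℍ[ℝ]) + y₂ • I₂ →
        c * (QuatBall.hypDist I₀ (QuatBall.sliceProj I₀ q₁) (QuatBall.sliceProj I₀ q₂)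
            + min (y₁ / ‖1 - q₁ ^ 2‖) (y₂ / ‖1 - q₂ ^ 2‖) * QuatBall.sphereDist I₁ I₂)
          ≤ QuatBall.gDist q₁ q₂ ∧
        QuatBall.gDist q₁ q₂
          ≤ C * (QuatBall.hypDist I₀ (QuatBall.sliceProj I₀ q₁) (QuatBall.sliceProj I₀ q₂)
            + min (y₁ / ‖1 - q₁ ^ 2‖) (y₂ / ‖1 - q₂ ^ 2‖) * QuatBall.sphereDist I₁ I₂) := by
  have hpi := Real.pi_pos
  -- The hyperbolic term is at most d_g and the angular term at most 2π d_g.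
  refine ⟨1 / (1 + 2 * Real.pi), 1, by positivity, one_pos, ?_⟩
  intro I₀ hI₀ q₁ hq₁ q₂ hq₂ x₁ y₁ x₂ y₂ hy₁ hy₂ I₁ hI₁ I₂ hI₂ h₁ h₂
  subst h₁ h₂
  have hS := QuatBall.sphereEDist_ne_top hI₁ hI₂
  have hH := QuatBall.hypEDist_ne_top
    ⟨QuatBall.coe_add_smul_mem_unitBall hI₁ hI₀ hq₁, QuatBall.coe_add_smul_mem_slice I₀ x₁ y₁⟩
    ⟨QuatBall.coe_add_smul_mem_unitBall hI₂ hI₀ hq₂, QuatBall.coe_add_smul_mem_slice I₀ x₂ y₂⟩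
  have hup := QuatBall.gEDist_le hI₀ hI₁ hI₂ hy₁ hy₂ hq₁ hq₂
  have hmS := fun m : ℝ => ENNReal.mul_ne_top (ENNReal.ofReal_ne_top (r := m)) hS
  -- The upper bound also supplies the finiteness of d_g that the lower bounds need.
  have hG := ne_top_of_le_ne_top (ENNReal.add_ne_top.2 ⟨hH, hmS _⟩) hup
  have hlow := ENNReal.toReal_mono hG (QuatBall.hypEDist_sliceProj_le hI₀ hq₁ hq₂ hG)
  have hup' := ENNReal.toReal_mono (ENNReal.add_ne_top.2 ⟨hH, hmS _⟩) hup
  rw [ENNReal.toReal_add hH (hmS _), ENNReal.toReal_mul,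
    ENNReal.toReal_ofReal (le_min (by positivity) (by positivity)),
    ← QuatBall.sliceProj_coe_add_smul hI₁ I₀ x₁ hy₁,
    ← QuatBall.sliceProj_coe_add_smul hI₂ I₀ x₂ hy₂] at hup'
  simp only [← QuatBall.lengthDist_eq_toReal] at hlow hup'
  refine ⟨?_, by rw [one_mul]; exact hup'⟩
  rw [one_div_mul_eq_div, div_le_iff₀ (by positivity), mul_add, mul_one,
    mul_comm (QuatBall.gDist _ _)]
  exact add_le_add hlow (QuatBall.min_mul_sphereDist_le hI₁ hI₂ hy₁ hy₂ hG)
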